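/- Let $\mathbb X(\mathbb C)$ be the space of formal power series $f=\sum_{n\ge 0}a_nz^n$ over $\mathbb C$, regarded through the single global chart $\phi(f)=(a_0,a_1,\dots)$ as a Fréchet manifold modeled on the Fréchet space $\mathbb C^{\mathbb N}$ of all complex sequences (seminorms $(a_n)\mapsto|a_k|$, $k\ge 0$; this is the topology of convergence of each coefficient). Write $[z^n]f=a_n$ and $\deg(f)=\sup\{n:a_n\neq0\}\in\mathbb N_0\cup\{+\infty\}$ (with $\deg(0)=0$). For $g=\sum_{k\ge0} b_kz^k\in\mathbb X(\mathbb C)$ let $r(g)\in[0,+\infty]$ be its radius of convergence, let $g'=\sum_{k\ge0}(k+1)b_{k+1}z^k$, let $$\mathbb X_g=\Big\{f\in\mathbb X(\mathbb C):\ \sum_{k=0}^\infty b_k\,[z^n]f^k\ \text{converges in }\mathbb C\text{ for every }n\in\mathbb N_0\Big\}$$ with the subspace topology, and let $T_g:\mathbb X_g\to\mathbb X(\mathbb C)$, $T_g(f)=g\circ f:=\sum_{n\ge0}\Big(\sum_{k=0}^\infty b_k\,[z^n]f^k\Big)z^n$. Smoothness is understood as follows. For complex topological vector spaces $E,F$,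 a set $A\subseteq E$ and $F_0:A\to F$, the derivative of $F_0$ at $x\in A$ in the direction $h\in E$ is $dF_0(x,h)=\lim_{t\to0}\frac{F_0(x+th)-F_0(x)}{t}$, the limit being taken along sequences of nonzero $t\in\mathbb C$ tending to $0$ with $x+th\in A$ (if there is no such sequence, the condition is void and any value is admitted). $F_0$ is $C^0$ on $A$ if it is continuous on $A$, and $C^{n+1}$ on $A$ if it is continuous on $A$ and has derivatives $dF_0(x,h)$ at all $x\in A$ in all directions $h\in E$ such that $dF_0:A\times E\to F$ is $C^n$ on $A\times E\subseteq E\times E$. It is smooth ($C^\infty$) on $A$ if it is $C^n$ on $A$ for every $n$, and smooth at $x\in A$ if it is smooth on some relatively open neighbourhood of $x$ in $A$. For $T_g$ these notions are applied in the chart $\phi$, with $A=\phi(\mathbb X_g)$. **Theorem.** Let $g\in\mathbb X(\mathbb C)$. a) If $r(g)=0$, then $T_g$ is smooth. b) If $r(g)>0$, then $T_g$ is smooth at every point $f=\sum_{n\ge0}a_nz^n\in\mathbb X_g$ such that (1) $|a_0|<r(g)$, or (2) $r(g)<+\infty$, $|a_0|=r(g)$ and $\deg(f)>0$. Moreover,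 for every $w\in\mathbb X_g$ if $r(g)=0$, and for every $w\in\mathbb X_g$ that satisfies (1) or (2) (with $w$ in place of $f$) if $r(g)>0$, we have $w\in\mathbb X_{g'}$, and for every $k\in\mathbb X(\mathbb C)$ the derivative of $T_g$ at $w$ in the direction $k$ is $$\lim_{t\to0}\frac{T_g(w+tk)-T_g(w)}{t}=(g'\circ w)\cdot k ,$$ the limit being taken along nonzero $t\in\mathbb C$ with $w+tk\in\mathbb X_g$ (if no such $t$ accumulate at $0$, this condition is void). -/

import Mathlib

open Filter Set Topology
open scoped PowerSeries PowerSeries.WithPiTopology ENNReal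

universe u v

/-! ### Formal power series over `ℂ`, general composition -/

namespace FPS

/-- The degree `max {n : a_n ≠ 0} ∈ ℕ₀ ∪ {+∞}` of `f = ∑ a_n z^n` (and `0` for the zero series). -/
noncomputable def deg (f : ℂ⟦X⟧) : ℕ∞ :=
  ⨆ n ∈ {n : ℕ | PowerSeries.coeff n f ≠ 0}, (n : ℕ∞)

/-- The radius of convergence of `g`, as an element of `[0, +∞]`. -/
noncomputable def convRadius (g : ℂ⟦X⟧) : ℝ≥0∞ :=
  (FormalMultilinearSeries.ofScalars ℂ (fun n => PowerSeries.coeff n g)).radius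

/-- The `N`-th partial sum `∑_{k < N} b_k a_n^{(k)}` of the series that defines the `n`-th
coefficient of `g ∘ f`, where `b_k = [z^k] g` and `a_n^{(k)} = [z^n] f^k`. -/
noncomputable def compPartialSum (g f : ℂ⟦X⟧) (n N : ℕ) : ℂ :=
  ∑ k ∈ Finset.range N, PowerSeries.coeff k g * PowerSeries.coeff n (f ^ k)

/-- The set `𝕏_g` of all `f` such that for every `n` the series `∑_k b_k a_n^{(k)}` converges
(as a limit of partial sums, possibly only conditionally). -/
def compDomain (g : ℂ⟦X⟧) : Set ℂ⟦X⟧ :=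
  {f | ∀ n : ℕ, ∃ c : ℂ, Tendsto (compPartialSum g f n) atTop (𝓝 c)}

/-- The superposition operator `T_g : f ↦ g ∘ f`; only its values on `compDomain g` matter. -/
noncomputable def comp (g f : ℂ⟦X⟧) : ℂ⟦X⟧ :=
  PowerSeries.mk fun n => limUnder atTop (compPartialSum g f n)

end FPS

/-! ### Smoothness through directional derivatives, on a possibly non-open domain -/

/-- `f : E → F` has at `x` the derivative `y` in the direction `h`, relative to the domain `A`:
`(f (x + t h) - f x) / t → y` as `t → 0`, where `t` runs over the nonzero scalars with
`x + t h ∈ A`. If `A` is a neighbourhood of `x`, the last restriction is void. -/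
def HasDirDeriv {E : Type u} {F : Type v} [AddCommGroup E] [Module ℂ E]
    [AddCommGroup F] [Module ℂ F] [TopologicalSpace F]
    (f : E → F) (A : Set E) (x h : E) (y : F) : Prop :=
  Tendsto (fun t : ℂ => t⁻¹ • (f (x + t • h) - f x))
    (𝓝[{t : ℂ | t ≠ 0 ∧ x + t • h ∈ A}] 0) (𝓝 y)

/-- `f` is of class `C^n` on `A`: it is continuous on `A`, and, if `n = m + 1`, it has directional
derivatives `df (x, h)` at all points `x` of `A` in all directions `h`, and the map `df` is of
class `C^m` on `A × E`. -/
def DirCn {F : Type v} [AddCommGroup F] [Module ℂ F] [TopologicalSpace F] :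
    ℕ → ∀ (E : Type u) [AddCommGroup E] [Module ℂ E] [TopologicalSpace E],
      (E → F) → Set E → Prop
  | 0, _, _, _, _, f, A => ContinuousOn f A
  | m + 1, E, _, _, _, f, A =>
      ContinuousOn f A ∧
        ∃ df : E × E → F,
          (∀ x ∈ A, ∀ h : E, HasDirDeriv f A x h (df (x, h))) ∧
            DirCn m (E × E) df (A ×ˢ (univ : Set E))

/-- `f` is smooth (`C^∞`) on `A`. -/
def DirSmoothOn {E : Type u} {F : Type v} [AddCommGroup E] [Module ℂ E] [TopologicalSpace E]
    [AddCommGroup F] [Module ℂ F] [TopologicalSpace F] (f : E → F) (A : Set E) : Prop :=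
  ∀ n : ℕ, DirCn n E f A

/-- `f : A → F` is smooth at the point `x ∈ A`: it is smooth on a neighbourhood of `x` in `A`,
for the subspace topology of `A`. -/
def DirSmoothAt {E : Type u} {F : Type v} [AddCommGroup E] [Module ℂ E] [TopologicalSpace E]
    [AddCommGroup F] [Module ℂ F] [TopologicalSpace F] (f : E → F) (A : Set E) (x : E) : Prop :=
  x ∈ A ∧ ∃ U : Set E, IsOpen U ∧ x ∈ U ∧ DirSmoothOn f (A ∩ U)

/-! ### The Fréchet manifold of formal power series -/

namespace FPS

/-- The global chart `∑ a_n z^n ↦ (a_0, a_1, …)` of the Fréchet manifold of formal power series,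
with values in the Fréchet space `ℂ^ℕ` of all sequences (with the product topology, that of the
seminorms `a ↦ |a_k|`). It is a linear homeomorphism. -/
noncomputable def chart : ℂ⟦X⟧ ≃L[ℂ] (ℕ → ℂ) where
  toFun f n := PowerSeries.coeff n f
  invFun a := PowerSeries.mk a
  left_inv f := by ext n; simp
  right_inv a := by ext n; simp
  map_add' f g := by ext n; simp
  map_smul' c f := by ext n; simp
  continuous_toFun :=
    continuous_pi fun n => PowerSeries.WithPiTopology.continuous_coeff ℂ n
  continuous_invFun := by
    refine continuous_iff_continuousAt.2 fun a => ?_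
    refine (PowerSeries.WithPiTopology.tendsto_iff_coeff_tendsto ℂ _ _ _).2 fun n => ?_
    simpa using (continuous_apply n).tendsto a

/-- A self-map of the space of formal power series, read in the global chart. -/
noncomputable def inChart (T : ℂ⟦X⟧ → ℂ⟦X⟧) : (ℕ → ℂ) → (ℕ → ℂ) :=
  fun a => chart (T (chart.symm a))

/-- `T`, with domain `A`, is smooth as a map between Fréchet manifolds modeled on `ℂ^ℕ`. -/
def SmoothOn (T : ℂ⟦X⟧ → ℂ⟦X⟧) (A : Set ℂ⟦X⟧) : Prop :=
  DirSmoothOn (inChart T) (chart '' A)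

/-- `T`, with domain `A`, is smooth at the point `f ∈ A` as a map between Fréchet manifolds
modeled on `ℂ^ℕ`. -/
def SmoothAt (T : ℂ⟦X⟧ → ℂ⟦X⟧) (A : Set ℂ⟦X⟧) (f : ℂ⟦X⟧) : Prop :=
  DirSmoothAt (inChart T) (chart '' A) (chart f)

end FPS

/-!
Write `g = ∑ b_k z^k` and `r` for its radius of convergence. Composition with `g` is smooth on every
set `{w | |w_0| ≤ s}` such that `∑ b_k z^k` and all its derived series
`∑ b_k (k choose j) z^(k-j)` converge absolutely at radius `s` (`FPS.AbsConvergentAt`). Indeed, if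
`W` is a real series with `W_0 = s` that majorizes `w` coefficientwise up to order `n`, then
`∑ |b_k| [z^n] W^k` is, by the binomial theorem, a finite combination of these derived series, so
it dominates the series `∑ b_k [z^n] w^k`, and similarly for its difference quotients. Dominated
convergence yields continuity of `w ↦ g ∘ w` (`FPS.AbsConvergentAt.continuousOn_comp`) and the
formula `(g' ∘ w) * k` for its derivative (`FPS.AbsConvergentAt.hasDirDeriv_comp`), both relative to
the closed disc, which is all that is needed for `|w_0| = s`. The hypothesis on `g` passes to `g'`,
so smoothness follows by induction from the product rule (`FPS.AbsConvergentAt.dirCn_comp`).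

It remains to see that every point `w` of the theorem has a neighbourhood in which the domain lies
in such a disc (`FPS.exists_absConvergentAt`). All points of the domain satisfy `|w_0| ≤ r`.

* If `r = 0`, take `s = 0`: the derived series are finite sums there.
* If `|w_0| < r`, take any `s` strictly between.
* If `|w_0| = r` and `w` is not constant, take `s = r`. The coefficients of `w^k` of order
  `0, m, 2m, …`, where `m` is the order of `w - w_0`, show inductively that the terms of each
  derived series at `w_0` tend to `0`. As this holds for all orders `j`, the terms decay faster
  than any power of `k`, which turns conditional into absolute convergence on the whole circle
  (`FPS.AbsConvergentAt.of_mem_compDomain`).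
-/

/-! ### Calculus of directional derivatives on arbitrary domains -/

namespace HasDirDeriv

variable {E E' : Type u} {F G : Type v} [AddCommGroup E] [Module ℂ E] [AddCommGroup E']
  [Module ℂ E'] [AddCommGroup F] [Module ℂ F] [TopologicalSpace F] [AddCommGroup G] [Module ℂ G]
  [TopologicalSpace G] {f : E → F} {A : Set E} {x h : E} {y : F}

/-- Only the points `x + t • h` with `t` close to `0` matter for the domain. -/
theorem mono_of_eventually {B : Set E} (hf : HasDirDeriv f A x h y)
    (hB : ∀ᶠ t : ℂ in 𝓝 0, x + t • h ∈ B → x + t • h ∈ A) : HasDirDeriv f B x h y := by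
  refine Tendsto.mono_left hf (le_inf inf_le_left (le_principal_iff.2 ?_))
  filter_upwards [mem_nhdsWithin_of_mem_nhds hB, self_mem_nhdsWithin] with t ht ht'
  exact ⟨ht'.1, ht ht'.2⟩

theorem comp_linear {B : Set E'} (L : E' →ₗ[ℂ] E) (hL : MapsTo L B A) {x k : E'}
    (hf : HasDirDeriv f A (L x) (L k) y) : HasDirDeriv (fun z => f (L z)) B x k y := by
  have key : Tendsto (fun t : ℂ => t⁻¹ • (f (L x + t • L k) - f (L x)))
      (𝓝[{t : ℂ | t ≠ 0 ∧ x + t • k ∈ B}] 0) (𝓝 y) :=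
    Tendsto.mono_left hf (nhdsWithin_mono _ fun t ht => ⟨ht.1, by simpa using hL ht.2⟩)
  simpa [HasDirDeriv] using key

theorem linear_comp (L : F →L[ℂ] G) (hf : HasDirDeriv f A x h y) :
    HasDirDeriv (fun z => L (f z)) A x h (L y) := by
  have key := (L.continuous.tendsto y).comp hf
  simpa [HasDirDeriv, Function.comp_def] using key

theorem linear (L : E →ₗ[ℂ] F) : HasDirDeriv L A x h (L h) := by
  refine tendsto_const_nhds.congr' ?_
  filter_upwards [self_mem_nhdsWithin] with t ht
  simp [smul_smul, inv_mul_cancel₀ ht.1]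

theorem add [ContinuousAdd F] {g : E → F} {z : F} (hf : HasDirDeriv f A x h y)
    (hg : HasDirDeriv g A x h z) : HasDirDeriv (fun u => f u + g u) A x h (y + z) := by
  refine (Tendsto.add hf hg).congr fun t => ?_
  rw [← smul_add, add_sub_add_comm]

theorem mul {R : Type v} [CommRing R] [Algebra ℂ R] [TopologicalSpace R] [IsTopologicalRing R]
    [TopologicalSpace E] [ContinuousAdd E] [ContinuousSMul ℂ E] {f g : E → R} {y z : R}
    (hx : x ∈ A) (hgc : ContinuousOn g A)
    (hf : HasDirDeriv f A x h y) (hg : HasDirDeriv g A x h z) :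
    HasDirDeriv (fun u => f u * g u) A x h (y * g x + f x * z) := by
  have hline : Tendsto (fun t : ℂ => x + t • h)
      (𝓝[{t : ℂ | t ≠ 0 ∧ x + t • h ∈ A}] 0) (𝓝[A] x) := by
    refine tendsto_nhdsWithin_of_tendsto_nhds_of_eventually_within _ ?_ ?_
    · have : Continuous fun t : ℂ => x + t • h := by fun_prop
      simpa using (this.tendsto 0).mono_left nhdsWithin_le_nhds
    · filter_upwards [self_mem_nhdsWithin] with t ht using ht.2
  have hgl := (hgc x hx).tendsto.comp hline
  refine ((Tendsto.mul hf hgl).add (Tendsto.mul tendsto_const_nhds hg)).congr fun t => ?_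
  simp only [Function.comp_apply, smul_mul_assoc, mul_smul_comm, ← smul_add]
  congr 1
  ring

end HasDirDeriv

/-! ### Calculus of `C^n` maps on arbitrary domains -/

namespace DirCn

variable {F G : Type v} [AddCommGroup F] [Module ℂ F] [TopologicalSpace F] [AddCommGroup G]
  [Module ℂ G] [TopologicalSpace G]

theorem continuousOn {n : ℕ} {E : Type u} [AddCommGroup E] [Module ℂ E] [TopologicalSpace E]
    {f : E → F} {A : Set E} (hf : DirCn n E f A) : ContinuousOn f A := by
  cases n with
  | zero => exact hf
  | succ n => exact hf.1

theorem of_succ {n : ℕ} {E : Type u} [AddCommGroup E] [Module ℂ E] [TopologicalSpace E]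
    {f : E → F} {A : Set E} (hf : DirCn (n + 1) E f A) : DirCn n E f A := by
  induction n generalizing E with
  | zero => exact hf.1
  | succ n ih =>
    obtain ⟨hc, df, hdf, hn⟩ := hf
    exact ⟨hc, df, hdf, ih hn⟩

theorem comp_linear {n : ℕ} {E E' : Type u} [AddCommGroup E] [Module ℂ E] [TopologicalSpace E]
    [AddCommGroup E'] [Module ℂ E'] [TopologicalSpace E'] {f : E → F} {A : Set E} {B : Set E'}
    (L : E' →L[ℂ] E) (hL : MapsTo L B A) (hf : DirCn n E f A) :
    DirCn n E' (fun x => f (L x)) B := by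
  induction n generalizing E E' with
  | zero => exact ContinuousOn.comp hf L.continuous.continuousOn hL
  | succ n ih =>
    obtain ⟨hc, df, hdf, hn⟩ := hf
    have hL' : MapsTo (L.prodMap L) (B ×ˢ univ) (A ×ˢ univ) := fun p hp => ⟨hL hp.1, mem_univ _⟩
    exact ⟨hc.comp L.continuous.continuousOn hL, fun p => df (L.prodMap L p),
      fun x hx h => (hdf (L x) (hL hx) (L h)).comp_linear (L : E' →ₗ[ℂ] E) hL,
      ih (L.prodMap L) hL' hn⟩

theorem linear_comp {n : ℕ} {E : Type u} [AddCommGroup E] [Module ℂ E] [TopologicalSpace E]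
    {f : E → F} {A : Set E} (L : F →L[ℂ] G) (hf : DirCn n E f A) :
    DirCn n E (fun x => L (f x)) A := by
  induction n generalizing E with
  | zero => exact L.continuous.comp_continuousOn hf
  | succ n ih =>
    obtain ⟨hc, df, hdf, hn⟩ := hf
    exact ⟨L.continuous.comp_continuousOn hc, fun p => L (df p),
      fun x hx h => (hdf x hx h).linear_comp L, ih hn⟩

theorem linear {n : ℕ} {E : Type u} [AddCommGroup E] [Module ℂ E] [TopologicalSpace E]
    (L : E →L[ℂ] F) (A : Set E) : DirCn n E L A := by
  induction n generalizing E with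
  | zero => exact L.continuous.continuousOn
  | succ n ih =>
    exact ⟨L.continuous.continuousOn, L.comp (ContinuousLinearMap.snd ℂ E E),
      fun x _ h => HasDirDeriv.linear (L : E →ₗ[ℂ] F), ih _ _⟩

theorem add [ContinuousAdd F] {n : ℕ} {E : Type u} [AddCommGroup E] [Module ℂ E]
    [TopologicalSpace E] {f g : E → F} {A : Set E} (hf : DirCn n E f A) (hg : DirCn n E g A) :
    DirCn n E (fun x => f x + g x) A := by
  induction n generalizing E with
  | zero => exact ContinuousOn.add hf hg
  | succ n ih =>
    obtain ⟨hc, df, hdf, hn⟩ := hf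
    obtain ⟨hc', dg, hdg, hn'⟩ := hg
    exact ⟨hc.add hc', fun p => df p + dg p, fun x hx h => (hdf x hx h).add (hdg x hx h),
      ih hn hn'⟩

theorem mul {R : Type v} [CommRing R] [Algebra ℂ R] [TopologicalSpace R] [IsTopologicalRing R]
    {n : ℕ} {E : Type u} [AddCommGroup E] [Module ℂ E] [TopologicalSpace E] [ContinuousAdd E]
    [ContinuousSMul ℂ E] {f g : E → R} {A : Set E} (hf : DirCn n E f A) (hg : DirCn n E g A) :
    DirCn n E (fun x => f x * g x) A := by
  induction n generalizing E with
  | zero => exact ContinuousOn.mul hf hg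
  | succ n ih =>
    have hfst : MapsTo (ContinuousLinearMap.fst ℂ E E) (A ×ˢ univ) A := fun p hp => hp.1
    have hf' := hf.of_succ.comp_linear _ hfst
    have hg' := hg.of_succ.comp_linear _ hfst
    obtain ⟨hc, df, hdf, hn⟩ := hf
    obtain ⟨hc', dg, hdg, hn'⟩ := hg
    exact ⟨hc.mul hc', fun p => df p * g p.1 + f p.1 * dg p,
      fun x hx h => (hdf x hx h).mul hx hc' (hdg x hx h), (ih hn hg').add (ih hf' hn')⟩

end DirCn

namespace FPS

/-! ### Coefficients of powers and their majorants -/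

theorem coeff_pow_eq_zero_of_lt {R : Type*} [CommRing R] {u : R⟦X⟧}
    (hu : PowerSeries.constantCoeff u = 0) {n j : ℕ} (h : n < j) :
    PowerSeries.coeff n (u ^ j) = 0 :=
  PowerSeries.X_pow_dvd_iff.1 (pow_dvd_pow_of_dvd (PowerSeries.X_dvd_iff.2 hu) j) n h

/-- The binomial theorem for `[z^n] (a + u)^k` when `u` has no constant term: only the powers
`u^j` with `j ≤ n` contribute, whatever `k` is. -/
theorem coeff_C_add_pow {R : Type*} [CommRing R] (a : R) {u : R⟦X⟧}
    (hu : PowerSeries.constantCoeff u = 0) (n k : ℕ) :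
    PowerSeries.coeff n ((PowerSeries.C a + u) ^ k) =
      ∑ j ∈ Finset.range (n + 1), k.choose j * a ^ (k - j) * PowerSeries.coeff n (u ^ j) := by
  have hterm : ∀ j, PowerSeries.coeff n (u ^ j * PowerSeries.C a ^ (k - j) * (k.choose j : R⟦X⟧))
      = k.choose j * a ^ (k - j) * PowerSeries.coeff n (u ^ j) := fun j => by
    have h : u ^ j * PowerSeries.C a ^ (k - j) * (k.choose j : R⟦X⟧) =
        PowerSeries.C (k.choose j * a ^ (k - j)) * u ^ j := by
      rw [map_mul, map_pow, map_natCast]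
      ring
    rw [h, PowerSeries.coeff_C_mul]
  rw [add_comm, add_pow, map_sum, Finset.sum_congr rfl fun j _ => hterm j]
  rcases le_total n k with hnk | hnk
  · refine (Finset.sum_subset (Finset.range_mono (by lia)) fun j _ hj => ?_).symm
    rw [coeff_pow_eq_zero_of_lt hu (by simpa using hj), mul_zero]
  · refine Finset.sum_subset (Finset.range_mono (by lia)) fun j _ hj => ?_
    rw [Nat.choose_eq_zero_of_lt (by simpa using hj)]
    simp

theorem coeff_geom_sum_mul {R : Type*} [CommRing R] (w k : R⟦X⟧) (n m : ℕ) :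
    PowerSeries.coeff n ((∑ i ∈ Finset.range (m + 1), w ^ i * w ^ (m + 1 - 1 - i)) * k) =
      ∑ p ∈ Finset.HasAntidiagonal.antidiagonal n,
        ((m : R) + 1) * PowerSeries.coeff p.1 (w ^ m) * PowerSeries.coeff p.2 k := by
  have hc : ((m + 1 : ℕ) : R⟦X⟧) = PowerSeries.C ((m : R) + 1) := by simp
  rw [geom_sum₂_self, Nat.add_sub_cancel, hc, mul_assoc, PowerSeries.coeff_C_mul,
    PowerSeries.coeff_mul, Finset.mul_sum]
  exact Finset.sum_congr rfl fun p _ => by ring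

/-- The coefficients of `f` up to order `n` are bounded by those of the real series `F`. Cutting
at order `n` makes this, for `F` with coefficients larger than those of `f`, a condition that
holds in a neighbourhood of `f`. -/
def MajorizedUpTo (n : ℕ) (f : ℂ⟦X⟧) (F : ℝ⟦X⟧) : Prop :=
  ∀ i ≤ n, ‖PowerSeries.coeff i f‖ ≤ PowerSeries.coeff i F

namespace MajorizedUpTo

variable {n : ℕ} {f g : ℂ⟦X⟧} {F G : ℝ⟦X⟧}

theorem mul (hf : MajorizedUpTo n f F) (hg : MajorizedUpTo n g G) :
    MajorizedUpTo n (f * g) (F * G) := by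
  intro i hi
  rw [PowerSeries.coeff_mul, PowerSeries.coeff_mul]
  refine (norm_sum_le _ _).trans (Finset.sum_le_sum fun p hp => ?_)
  have hp' := Finset.HasAntidiagonal.mem_antidiagonal.1 hp
  rw [norm_mul]
  have h₁ := hf p.1 (by lia)
  exact mul_le_mul h₁ (hg p.2 (by lia)) (norm_nonneg _) ((norm_nonneg _).trans h₁)

theorem pow (hf : MajorizedUpTo n f F) (k : ℕ) : MajorizedUpTo n (f ^ k) (F ^ k) := by
  induction k with
  | zero =>
    intro i _
    rcases eq_or_ne i 0 with rfl | h <;> simp [PowerSeries.coeff_one, *]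
  | succ k ih =>
    rw [pow_succ, pow_succ]
    exact ih.mul hf

theorem sum {ι : Type*} (s : Finset ι) {f : ι → ℂ⟦X⟧} {F : ι → ℝ⟦X⟧}
    (h : ∀ i ∈ s, MajorizedUpTo n (f i) (F i)) :
    MajorizedUpTo n (∑ i ∈ s, f i) (∑ i ∈ s, F i) := by
  intro i hi
  rw [map_sum, map_sum]
  exact (norm_sum_le _ _).trans (Finset.sum_le_sum fun j hj => h j hj i hi)

end MajorizedUpTo

/-! ### Composition on a closed disc of absolute convergence -/

/-- The series `∑ b_k z^k` of `g` and all its (divided) derivatives `∑ b_k (k choose j) z^(k-j)`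
converge absolutely on the circle of radius `s`, hence uniformly on the closed disc. For `s = 0`
this always holds: the truncated subtraction `k - j` does no harm for `k < j`, where
`k.choose j = 0`, so that only the term `k = j` is left. -/
def AbsConvergentAt (g : ℂ⟦X⟧) (s : ℝ) : Prop :=
  ∀ j : ℕ, Summable fun k : ℕ => ‖PowerSeries.coeff k g‖ * (k.choose j * s ^ (k - j))

namespace AbsConvergentAt

variable {g : ℂ⟦X⟧} {s : ℝ}

theorem zero (g : ℂ⟦X⟧) : AbsConvergentAt g 0 := by
  intro j
  refine summable_of_ne_finset_zero (s := {j}) fun k hk => ?_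
  rcases lt_or_gt_of_ne (Finset.notMem_singleton.1 hk) with h | h
  · simp [Nat.choose_eq_zero_of_lt h]
  · rw [zero_pow (by lia)]
    simp

theorem derivative (hg : AbsConvergentAt g s) : AbsConvergentAt (PowerSeries.derivative ℂ g) s := by
  intro j
  refine (((summable_nat_add_iff 1).2 (hg (j + 1))).mul_left ((j : ℝ) + 1)).congr fun k => ?_
  have h : ((k : ℝ) + 1) * k.choose j = (k + 1).choose (j + 1) * ((j : ℝ) + 1) := by
    exact_mod_cast Nat.add_one_mul_choose_eq k j
  have hk : ‖(k : ℂ) + 1‖ = (k : ℝ) + 1 := by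
    exact_mod_cast Complex.norm_natCast (k + 1)
  rw [PowerSeries.coeff_derivative, norm_mul, hk,
    Nat.add_sub_add_right]
  linear_combination -‖PowerSeries.coeff (k + 1) g‖ * s ^ (k - j) * h

theorem summable_majorant (hg : AbsConvergentAt g s) {W : ℝ⟦X⟧}
    (hW : PowerSeries.constantCoeff W = s) (n : ℕ) :
    Summable fun k : ℕ => ‖PowerSeries.coeff k g‖ * PowerSeries.coeff n (W ^ k) := by
  have hu : PowerSeries.constantCoeff (W - PowerSeries.C s) = 0 := by simp [hW]
  have hsum : Summable fun k : ℕ => ∑ j ∈ Finset.range (n + 1),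
      ‖PowerSeries.coeff k g‖ * (k.choose j * s ^ (k - j)) *
        PowerSeries.coeff n ((W - PowerSeries.C s) ^ j) :=
    summable_sum fun j _ => (hg j).mul_right _
  refine hsum.congr fun k => ?_
  have h := coeff_C_add_pow s hu n k
  rw [add_sub_cancel] at h
  rw [h, Finset.mul_sum]
  exact Finset.sum_congr rfl fun j _ => by ring

/-- The series whose terms bound those of the difference quotients of `w ↦ g ∘ w`. -/
theorem summable_majorant_deriv (hg : AbsConvergentAt g s) {W : ℝ⟦X⟧}
    (hW : PowerSeries.constantCoeff W = s) (K : ℝ⟦X⟧) (n : ℕ) :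
    Summable fun k : ℕ => ‖PowerSeries.coeff k g‖ *
      PowerSeries.coeff n ((∑ i ∈ Finset.range k, W ^ i * W ^ (k - 1 - i)) * K) := by
  rw [← summable_nat_add_iff 1]
  have hsum : Summable fun k : ℕ => ∑ p ∈ Finset.HasAntidiagonal.antidiagonal n,
      ‖PowerSeries.coeff k (PowerSeries.derivative ℂ g)‖ * PowerSeries.coeff p.1 (W ^ k) *
        PowerSeries.coeff p.2 K :=
    summable_sum fun p _ => (hg.derivative.summable_majorant hW p.1).mul_right _
  refine hsum.congr fun k => ?_
  have hk : ‖(k : ℂ) + 1‖ = (k : ℝ) + 1 := by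
    exact_mod_cast Complex.norm_natCast (k + 1)
  rw [coeff_geom_sum_mul, PowerSeries.coeff_derivative, norm_mul, hk, Finset.mul_sum]
  exact Finset.sum_congr rfl fun p _ => by ring

variable (hg : AbsConvergentAt g s) {w : ℂ⟦X⟧} (hw : ‖PowerSeries.coeff 0 w‖ ≤ s)
include hg hw

theorem summable (n : ℕ) :
    Summable fun k : ℕ => PowerSeries.coeff k g * PowerSeries.coeff n (w ^ k) := by
  let W : ℝ⟦X⟧ := PowerSeries.mk fun i => if i = 0 then s else ‖PowerSeries.coeff i w‖
  have hW : PowerSeries.constantCoeff W = s := by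
    simp [W, ← PowerSeries.coeff_zero_eq_constantCoeff_apply]
  have hmaj : MajorizedUpTo n w W := fun i _ => by
    rcases eq_or_ne i 0 with rfl | h
    · simpa [W] using hw
    · simp [W, h]
  refine Summable.of_norm_bounded (hg.summable_majorant hW n) fun k => ?_
  rw [norm_mul]
  exact mul_le_mul_of_nonneg_left (hmaj.pow k n le_rfl) (norm_nonneg _)

theorem tendsto_compPartialSum (n : ℕ) :
    Tendsto (compPartialSum g w n) atTop
      (𝓝 (∑' k : ℕ, PowerSeries.coeff k g * PowerSeries.coeff n (w ^ k))) :=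
  (hg.summable hw n).hasSum.tendsto_sum_nat

theorem mem_compDomain : w ∈ compDomain g := fun n => ⟨_, hg.tendsto_compPartialSum hw n⟩

theorem coeff_comp (n : ℕ) :
    PowerSeries.coeff n (comp g w) =
      ∑' k : ℕ, PowerSeries.coeff k g * PowerSeries.coeff n (w ^ k) := by
  rw [comp, PowerSeries.coeff_mk]
  exact (hg.tendsto_compPartialSum hw n).limUnder_eq

theorem coeff_comp_derivative_mul (k : ℂ⟦X⟧) (n : ℕ) :
    PowerSeries.coeff n (comp (PowerSeries.derivative ℂ g) w * k) =
      ∑' m : ℕ, PowerSeries.coeff m g *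
        PowerSeries.coeff n ((∑ i ∈ Finset.range m, w ^ i * w ^ (m - 1 - i)) * k) := by
  have hsum : ∀ p ∈ Finset.HasAntidiagonal.antidiagonal n, Summable fun m : ℕ =>
      PowerSeries.coeff m (PowerSeries.derivative ℂ g) * PowerSeries.coeff p.1 (w ^ m) *
        PowerSeries.coeff p.2 k :=
    fun p _ => (hg.derivative.summable hw p.1).mul_right _
  have hterm : ∀ m : ℕ, ∑ p ∈ Finset.HasAntidiagonal.antidiagonal n,
      PowerSeries.coeff m (PowerSeries.derivative ℂ g) * PowerSeries.coeff p.1 (w ^ m) *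
        PowerSeries.coeff p.2 k = PowerSeries.coeff (m + 1) g * PowerSeries.coeff n
          ((∑ i ∈ Finset.range (m + 1), w ^ i * w ^ (m + 1 - 1 - i)) * k) := fun m => by
    rw [coeff_geom_sum_mul, PowerSeries.coeff_derivative, Finset.mul_sum]
    exact Finset.sum_congr rfl fun p _ => by ring
  have hF : Summable fun m : ℕ => PowerSeries.coeff m g *
      PowerSeries.coeff n ((∑ i ∈ Finset.range m, w ^ i * w ^ (m - 1 - i)) * k) :=
    (summable_nat_add_iff 1).1 ((summable_sum hsum).congr hterm)
  have hshift := hF.tsum_eq_zero_add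
  rw [hshift, ← tsum_congr hterm, Summable.tsum_finsetSum hsum, PowerSeries.coeff_mul]
  simp only [hg.derivative.coeff_comp hw, tsum_mul_right]
  simp

omit hw in
/-- Continuity up to the boundary of the disc, by dominated convergence: near `w` a single majorant
with constant coefficient exactly `s` works, because the constant coefficient is bounded by the
domain and the finitely many others that matter by the neighbourhood. -/
theorem continuousOn_comp : ContinuousOn (comp g) {w | ‖PowerSeries.coeff 0 w‖ ≤ s} := by
  intro w hw
  refine (PowerSeries.WithPiTopology.tendsto_iff_coeff_tendsto ℂ _ _ _).2 fun n => ?_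
  let W : ℝ⟦X⟧ := PowerSeries.mk fun i => if i = 0 then s else ‖PowerSeries.coeff i w‖ + 1
  have hW : PowerSeries.constantCoeff W = s := by
    simp [W, ← PowerSeries.coeff_zero_eq_constantCoeff_apply]
  have hmaj : ∀ᶠ v in 𝓝[{w | ‖PowerSeries.coeff 0 w‖ ≤ s}] w, MajorizedUpTo n v W := by
    have h : ∀ᶠ v in 𝓝 w, ∀ i ∈ Finset.range (n + 1),
        ‖PowerSeries.coeff i v‖ < ‖PowerSeries.coeff i w‖ + 1 :=
      (Finset.eventually_all _).2 fun i _ =>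
        ((PowerSeries.WithPiTopology.continuous_coeff ℂ i).norm.tendsto w).eventually_lt_const
          (lt_add_one _)
    filter_upwards [nhdsWithin_le_nhds h, self_mem_nhdsWithin] with v hv hv₀ i hi
    rcases eq_or_ne i 0 with rfl | h
    · simpa [W] using hv₀
    · simpa [W, h] using (hv i (Finset.mem_range.2 (by lia))).le
  rw [hg.coeff_comp hw]
  refine Tendsto.congr' (f₁ := fun v : ℂ⟦X⟧ =>
      ∑' k : ℕ, PowerSeries.coeff k g * PowerSeries.coeff n (v ^ k)) ?_
    (tendsto_tsum_of_dominated_convergence (hg.summable_majorant hW n) (fun k => ?_) ?_)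
  · filter_upwards [self_mem_nhdsWithin] with v hv using (hg.coeff_comp hv n).symm
  · have : Continuous fun v : ℂ⟦X⟧ => PowerSeries.coeff k g * PowerSeries.coeff n (v ^ k) :=
      continuous_const.mul ((PowerSeries.WithPiTopology.continuous_coeff ℂ n).comp
        (continuous_pow k))
    exact (this.tendsto w).mono_left nhdsWithin_le_nhds
  · filter_upwards [hmaj] with v hv k
    rw [norm_mul]
    exact mul_le_mul_of_nonneg_left (hv.pow k n le_rfl) (norm_nonneg _)

/-- Termwise differentiation: by `x^m - y^m = (∑ x^i y^(m-1-i)) (x - y)` the difference quotients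
are series with terms `b_m [z^n] ((∑ (w + t k)^i w^(m-1-i)) k)`, dominated uniformly in `t` as long
as `w + t k` stays in the disc. -/
theorem hasDirDeriv_comp (k : ℂ⟦X⟧) :
    HasDirDeriv (comp g) {w | ‖PowerSeries.coeff 0 w‖ ≤ s} w k
      (comp (PowerSeries.derivative ℂ g) w * k) := by
  refine (PowerSeries.WithPiTopology.tendsto_iff_coeff_tendsto ℂ _ _ _).2 fun n => ?_
  let W : ℝ⟦X⟧ := PowerSeries.mk fun i =>
    if i = 0 then s else ‖PowerSeries.coeff i w‖ + ‖PowerSeries.coeff i k‖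
  let K : ℝ⟦X⟧ := PowerSeries.mk fun i => ‖PowerSeries.coeff i k‖
  have hW : PowerSeries.constantCoeff W = s := by
    simp [W, ← PowerSeries.coeff_zero_eq_constantCoeff_apply]
  have hK : MajorizedUpTo n k K := fun i _ => by simp [K]
  have hwW : MajorizedUpTo n w W := fun i _ => by
    rcases eq_or_ne i 0 with rfl | h
    · simpa [W] using hw
    · simp [W, h]
  have hsmall : ∀ᶠ t : ℂ in 𝓝 0, ‖t‖ < 1 :=
    (continuous_norm.tendsto (0 : ℂ)).eventually_lt_const (by simp)
  rw [hg.coeff_comp_derivative_mul hw]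
  refine Tendsto.congr' (f₁ := fun t : ℂ => ∑' m : ℕ, PowerSeries.coeff m g *
      PowerSeries.coeff n ((∑ i ∈ Finset.range m, (w + t • k) ^ i * w ^ (m - 1 - i)) * k)) ?_
    (tendsto_tsum_of_dominated_convergence (hg.summable_majorant_deriv hW K n) (fun m => ?_) ?_)
  · filter_upwards [self_mem_nhdsWithin] with t ht
    rw [PowerSeries.coeff_smul, map_sub, hg.coeff_comp ht.2, hg.coeff_comp hw,
      ← (hg.summable ht.2 n).tsum_sub (hg.summable hw n), smul_eq_mul, ← tsum_mul_left]
    refine tsum_congr fun m => ?_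
    have h := geom_sum₂_mul (w + t • k) w m
    rw [add_sub_cancel_left, mul_smul_comm] at h
    rw [← mul_sub, ← map_sub, ← h, PowerSeries.coeff_smul, smul_eq_mul]
    field_simp [ht.1]
  · have hpow : Continuous fun t : ℂ =>
        (∑ i ∈ Finset.range m, (w + t • k) ^ i * w ^ (m - 1 - i)) * k := by
      simp only [PowerSeries.smul_eq_C_mul]
      have := PowerSeries.WithPiTopology.continuous_C (R := ℂ)
      fun_prop
    have : Continuous fun t : ℂ => PowerSeries.coeff m g * PowerSeries.coeff n
        ((∑ i ∈ Finset.range m, (w + t • k) ^ i * w ^ (m - 1 - i)) * k) :=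
      continuous_const.mul ((PowerSeries.WithPiTopology.continuous_coeff ℂ n).comp hpow)
    simpa using (this.tendsto 0).mono_left nhdsWithin_le_nhds
  · filter_upwards [nhdsWithin_le_nhds hsmall, self_mem_nhdsWithin] with t ht₁ ht m
    have htW : MajorizedUpTo n (w + t • k) W := fun i _ => by
      rcases eq_or_ne i 0 with rfl | h
      · simpa [W] using ht.2
      · simp only [W, h, PowerSeries.coeff_mk, if_false, map_add, PowerSeries.coeff_smul,
          smul_eq_mul]
        refine (norm_add_le _ _).trans (add_le_add le_rfl ?_)
        rw [norm_mul]
        exact mul_le_of_le_one_left (norm_nonneg _) ht₁.le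
    rw [norm_mul]
    exact mul_le_mul_of_nonneg_left
      (((MajorizedUpTo.sum _ fun i _ => (htW.pow i).mul (hwW.pow _)).mul hK) n le_rfl)
      (norm_nonneg _)

omit hw in
/-- The formula `d(g ∘ w)(k) = (g' ∘ w) · k` and the product rule reduce `C^(n+1)` for `g` to
`C^n` for `g'`, to which the same hypothesis applies. -/
theorem dirCn_comp (n : ℕ) :
    DirCn n (ℕ → ℂ) (fun a => comp g (chart.symm a)) {a | ‖a 0‖ ≤ s} := by
  have hmaps : MapsTo chart.symm {a | ‖a 0‖ ≤ s} {w | ‖PowerSeries.coeff 0 w‖ ≤ s} :=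
    fun a ha => show ‖PowerSeries.coeff 0 (PowerSeries.mk a)‖ ≤ s by
      rwa [PowerSeries.coeff_mk]
  induction n generalizing g with
  | zero => exact hg.continuousOn_comp.comp chart.symm.continuous.continuousOn hmaps
  | succ n ih =>
    refine ⟨hg.continuousOn_comp.comp chart.symm.continuous.continuousOn hmaps,
      fun p => comp (PowerSeries.derivative ℂ g) (chart.symm p.1) * chart.symm p.2, ?_, ?_⟩
    · exact fun a ha h => (hg.hasDirDeriv_comp (hmaps ha) (chart.symm h)).comp_linear
        (chart.symm : (ℕ → ℂ) →ₗ[ℂ] ℂ⟦X⟧) hmaps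
    · have h₁ : DirCn n ((ℕ → ℂ) × (ℕ → ℂ))
          (fun p => comp (PowerSeries.derivative ℂ g) (chart.symm p.1))
          ({a | ‖a 0‖ ≤ s} ×ˢ univ) :=
        (ih hg.derivative).comp_linear (ContinuousLinearMap.fst ℂ (ℕ → ℂ) (ℕ → ℂ)) fun p hp => hp.1
      have h₂ : DirCn n ((ℕ → ℂ) × (ℕ → ℂ)) (fun p => chart.symm p.2)
          ({a : ℕ → ℂ | ‖a 0‖ ≤ s} ×ˢ univ) :=
        (DirCn.linear (chart.symm : (ℕ → ℂ) →L[ℂ] ℂ⟦X⟧) univ).comp_linear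
          (ContinuousLinearMap.snd ℂ (ℕ → ℂ) (ℕ → ℂ)) fun p _ => mem_univ p.2
      exact h₁.mul h₂

omit hw in
theorem dirSmoothOn_comp {A : Set (ℕ → ℂ)} (hA : ∀ a ∈ A, ‖a 0‖ ≤ s) :
    DirSmoothOn (inChart (comp g)) A := by
  intro n
  have h : MapsTo (ContinuousLinearMap.id ℂ (ℕ → ℂ)) A {a | ‖a 0‖ ≤ s} := hA
  exact ((hg.dirCn_comp n).comp_linear _ h).linear_comp (chart : ℂ⟦X⟧ →L[ℂ] (ℕ → ℂ))

end AbsConvergentAt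

end FPS

/-! ### Which closed discs are discs of absolute convergence -/

namespace FPS

variable {g w : ℂ⟦X⟧}

theorem tendsto_term_of_mem_compDomain (hw : w ∈ compDomain g) (n : ℕ) :
    Tendsto (fun k => PowerSeries.coeff k g * PowerSeries.coeff n (w ^ k)) atTop (𝓝 0) := by
  obtain ⟨c, hc⟩ := hw n
  have h := (hc.comp (tendsto_add_atTop_nat 1)).sub hc
  rw [sub_self] at h
  refine h.congr fun k => ?_
  simp [compPartialSum, Finset.sum_range_succ]

theorem enorm_coeff_zero_le_convRadius (hw : w ∈ compDomain g) :
    ‖PowerSeries.coeff 0 w‖ₑ ≤ convRadius g := by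
  refine FormalMultilinearSeries.le_radius_of_tendsto (l := 0) _ ?_
  refine (tendsto_zero_iff_norm_tendsto_zero.1 (tendsto_term_of_mem_compDomain hw 0)).congr
    fun k => ?_
  simp

namespace AbsConvergentAt

theorem of_lt_convRadius {s : NNReal} (hs : (s : ℝ≥0∞) < convRadius g) :
    AbsConvergentAt g s := by
  intro j
  obtain ⟨r, hsr, hr⟩ := ENNReal.lt_iff_exists_nnreal_btwn.1 hs
  have hsr' : (s : ℝ) < r := by exact_mod_cast hsr
  have hr₀ : (0 : ℝ) < r := s.2.trans_lt hsr'
  obtain ⟨C, -, hC⟩ := FormalMultilinearSeries.norm_mul_pow_le_of_lt_radius _ hr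
  simp only [FormalMultilinearSeries.ofScalars_norm] at hC
  have hq : ‖(s : ℝ) / r‖ < 1 := by
    rw [Real.norm_of_nonneg (by positivity)]
    exact (div_lt_one hr₀).2 hsr'
  rw [← summable_nat_add_iff j]
  refine Summable.of_nonneg_of_le (fun k => by positivity) (fun k => ?_)
    ((summable_choose_mul_geometric_of_norm_lt_one j hq).mul_left (C / (r : ℝ) ^ j))
  have h := (le_div_iff₀ (pow_pos hr₀ _)).2 (hC (k + j))
  rw [Nat.add_sub_cancel]
  calc _ ≤ C / (r : ℝ) ^ (k + j) * ((k + j).choose j * (s : ℝ) ^ k) :=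
        mul_le_mul_of_nonneg_right h (by positivity)
    _ = _ := by
        rw [div_pow, pow_add]
        field_simp

/-- If the terms of all the derived series tend to `0` at radius `s`, then all these series
converge absolutely there: the terms of order `j + 2` are those of order `j` times a quadratic
factor in the index. -/
theorem of_tendsto_zero {s : ℝ} (hs : 0 ≤ s)
    (h : ∀ j : ℕ, Tendsto (fun k : ℕ => ‖PowerSeries.coeff k g‖ * (k.choose j * s ^ (k - j)))
      atTop (𝓝 0)) : AbsConvergentAt g s := by
  intro j
  obtain ⟨M, hM⟩ := (h (j + 2)).bddAbove_range
  have hM' := fun k => hM (mem_range_self k)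
  have hsum : Summable fun p : ℕ =>
      M * s ^ 2 * ((j + 1) * (j + 2)) * (1 / ((p + 1 : ℕ) : ℝ) ^ 2) :=
    ((summable_nat_add_iff 1).2 (Real.summable_one_div_nat_pow.2 one_lt_two)).mul_left _
  rw [← summable_nat_add_iff (j + 2)]
  refine Summable.of_nonneg_of_le (fun p => by positivity) (fun p => ?_) hsum
  have hchoose : ((p + (j + 2)).choose j : ℝ) * ((p + 2) * (p + 1)) =
      (p + (j + 2)).choose (j + 2) * ((j + 1) * (j + 2)) := by
    have h₁ := Nat.choose_succ_right_eq (p + (j + 2)) j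
    have h₂ := Nat.choose_succ_right_eq (p + (j + 2)) (j + 1)
    rw [show p + (j + 2) - j = p + 2 by lia] at h₁
    rw [show p + (j + 2) - (j + 1) = p + 1 by lia] at h₂
    have h₁' : ((p + (j + 2)).choose (j + 1) : ℝ) * (j + 1) =
      (p + (j + 2)).choose j * (p + 2) := by exact_mod_cast h₁
    have h₂' : ((p + (j + 2)).choose (j + 2) : ℝ) * (j + 2) =
      (p + (j + 2)).choose (j + 1) * (p + 1) := by exact_mod_cast h₂
    linear_combination -(p + 1 : ℝ) * h₁' - (j + 1 : ℝ) * h₂'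
  have hMp := hM' (p + (j + 2))
  simp only [Nat.add_sub_cancel] at hMp
  have hM₀ : 0 ≤ M := le_trans (by positivity) hMp
  rw [show p + (j + 2) - j = p + 2 by lia]
  calc ‖PowerSeries.coeff (p + (j + 2)) g‖ * ((p + (j + 2)).choose j * s ^ (p + 2))
      = ‖PowerSeries.coeff (p + (j + 2)) g‖ * ((p + (j + 2)).choose (j + 2) * s ^ p) * s ^ 2 *
          ((j + 1) * (j + 2)) * (1 / ((p + 2) * (p + 1))) := by
        field_simp
        linear_combination ‖PowerSeries.coeff (p + (j + 2)) g‖ * s ^ (p + 2) * hchoose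
    _ ≤ M * s ^ 2 * ((j + 1) * (j + 2)) * (1 / ((p + 1 : ℕ) : ℝ) ^ 2) := by
        have hp : 1 / (((p : ℝ) + 2) * (p + 1)) ≤ 1 / ((p + 1 : ℕ) : ℝ) ^ 2 := by
          refine one_div_le_one_div_of_le (by positivity) ?_
          push_cast
          nlinarith [(Nat.cast_nonneg p : (0 : ℝ) ≤ p)]
        gcongr

/-- A non-constant `w` in the domain forces absolute convergence of all derived series at radius
`|w_0|`. If `m` is the order of `w - w_0`, then for `n = m * j` the binomial expansion of
`[z^n] w^k` ends with the term of order `j`, so that by induction on `j` the terms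
`b_k (k choose j) w_0^(k-j)` tend to `0`. -/
theorem of_mem_compDomain (hw : w ∈ compDomain g) (hdeg : 0 < deg w) :
    AbsConvergentAt g ‖PowerSeries.coeff 0 w‖ := by
  obtain ⟨l, hl₀, hl⟩ : ∃ l : ℕ, 0 < l ∧ PowerSeries.coeff l w ≠ 0 := by
    by_contra! hcon
    refine hdeg.not_ge (iSup₂_le fun l hl => ?_)
    rcases Nat.eq_zero_or_pos l with rfl | h
    · simp
    · exact absurd (hcon l h) hl
  set a := PowerSeries.coeff 0 w with ha
  set u := w - PowerSeries.C a with hu_def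
  have hu : PowerSeries.constantCoeff u = 0 := by simp [hu_def, ha]
  have hwu : w = PowerSeries.C a + u := by rw [hu_def, add_sub_cancel]
  have hu₀ : u ≠ 0 := fun h => hl <| by
    rw [hwu, h, add_zero, PowerSeries.coeff_C, if_neg hl₀.ne']
  obtain ⟨m, v, hv, huv⟩ : ∃ (m : ℕ) (v : ℂ⟦X⟧), PowerSeries.coeff 0 v ≠ 0 ∧
      u = PowerSeries.X ^ m * v := by
    have hex := PowerSeries.exists_coeff_ne_zero_iff_ne_zero.2 hu₀
    classical
    obtain ⟨v, hv⟩ := PowerSeries.X_pow_dvd_iff.2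
      fun i (hi : i < Nat.find hex) => not_not.1 (Nat.find_min hex hi)
    refine ⟨Nat.find hex, v, fun h => Nat.find_spec hex ((congrArg _ hv).trans ?_), hv⟩
    rw [PowerSeries.coeff_X_pow_mul', if_pos le_rfl, Nat.sub_self, h]
  have hm : 0 < m := by
    refine Nat.pos_of_ne_zero fun h => hv ?_
    rw [h, pow_zero, one_mul] at huv
    rw [← huv]
    simpa using hu
  have hlt : ∀ i j, j < i → PowerSeries.coeff (m * j) (u ^ i) = 0 := fun i j hij => by
    rw [huv, mul_pow, ← pow_mul, PowerSeries.coeff_X_pow_mul',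
      if_neg (not_le.2 (Nat.mul_lt_mul_of_pos_left hij hm))]
  have heq : ∀ j, PowerSeries.coeff (m * j) (u ^ j) = PowerSeries.coeff 0 v ^ j := fun j => by
    rw [huv, mul_pow, ← pow_mul, PowerSeries.coeff_X_pow_mul', if_pos le_rfl, Nat.sub_self]
    simp
  have key : ∀ j : ℕ, Tendsto (fun k : ℕ => PowerSeries.coeff k g * (k.choose j * a ^ (k - j)))
      atTop (𝓝 0) := by
    intro j
    induction j using Nat.strong_induction_on with
    | _ j ih =>
      have hexp : ∀ k, PowerSeries.coeff k g * PowerSeries.coeff (m * j) (w ^ k) =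
          ∑ i ∈ Finset.range j, PowerSeries.coeff k g * (k.choose i * a ^ (k - i)) *
            PowerSeries.coeff (m * j) (u ^ i) +
          PowerSeries.coeff k g * (k.choose j * a ^ (k - j)) * PowerSeries.coeff 0 v ^ j := by
        intro k
        rw [hwu, coeff_C_add_pow a hu, ← heq, ← Finset.sum_range_succ (fun i =>
          PowerSeries.coeff k g * (k.choose i * a ^ (k - i)) * PowerSeries.coeff (m * j) (u ^ i)),
          Finset.mul_sum, Finset.sum_congr rfl fun i _ => (mul_assoc _ _ _).symm]
        refine (Finset.sum_subset (Finset.range_mono ?_) fun i _ hi => ?_).symm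
        · have := Nat.le_mul_of_pos_left j hm
          lia
        · rw [hlt i j (by simpa using hi), mul_zero]
      have hlow : Tendsto (fun k : ℕ => ∑ i ∈ Finset.range j, PowerSeries.coeff k g *
          (k.choose i * a ^ (k - i)) * PowerSeries.coeff (m * j) (u ^ i)) atTop (𝓝 0) := by
        simpa using tendsto_finsetSum (Finset.range j) fun i hi =>
          (ih i (Finset.mem_range.1 hi)).mul_const (PowerSeries.coeff (m * j) (u ^ i))
      have h := ((tendsto_term_of_mem_compDomain hw (m * j)).sub hlow).mul_const
        (PowerSeries.coeff 0 v ^ j)⁻¹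
      rw [sub_zero, zero_mul] at h
      refine h.congr fun k => ?_
      rw [hexp, add_sub_cancel_left, mul_assoc, mul_inv_cancel₀ (pow_ne_zero j hv), mul_one]
  refine of_tendsto_zero (norm_nonneg a) fun j => (tendsto_zero_iff_norm_tendsto_zero.1
    (key j)).congr fun k => ?_
  simp

end AbsConvergentAt

/-- At each point covered by the theorem, the domain of `w ↦ g ∘ w` is locally contained in a
closed disc `|w_0| ≤ s` of absolute convergence; a neighbourhood
smaller than the whole space is needed only if `|w_0|` is less than the radius. -/
theorem exists_absConvergentAt (hw : w ∈ compDomain g)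
    (h : convRadius g = 0 ∨ 0 < convRadius g ∧ (‖PowerSeries.coeff 0 w‖ₑ < convRadius g ∨
      convRadius g < ⊤ ∧ ‖PowerSeries.coeff 0 w‖ₑ = convRadius g ∧ 0 < deg w)) :
    ∃ s : ℝ, AbsConvergentAt g s ∧ ‖PowerSeries.coeff 0 w‖ ≤ s ∧
      ∃ U : Set ℂ⟦X⟧, IsOpen U ∧ w ∈ U ∧ ∀ v ∈ compDomain g ∩ U, ‖PowerSeries.coeff 0 v‖ ≤ s := by
  rcases h with h | ⟨-, h | ⟨-, h, hdeg⟩⟩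
  · have hzero : ∀ v ∈ compDomain g, ‖PowerSeries.coeff 0 v‖ ≤ 0 := fun v hv => by
      simpa [h] using enorm_coeff_zero_le_convRadius hv
    exact ⟨0, .zero g, hzero w hw, univ, isOpen_univ, mem_univ w, fun v hv => hzero v hv.1⟩
  · obtain ⟨s, hws, hs⟩ := ENNReal.lt_iff_exists_nnreal_btwn.1 h
    have hws' : ‖PowerSeries.coeff 0 w‖ < s := by
      rw [enorm_eq_nnnorm] at hws
      exact_mod_cast hws
    exact ⟨s, .of_lt_convRadius hs, hws'.le, {v | ‖PowerSeries.coeff 0 v‖ < s},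
      isOpen_lt (PowerSeries.WithPiTopology.continuous_coeff ℂ 0).norm continuous_const, hws',
      fun v hv => hv.2.le⟩
  · refine ⟨_, .of_mem_compDomain hw hdeg, le_rfl, univ, isOpen_univ, mem_univ w,
      fun v hv => ?_⟩
    have hv' := enorm_coeff_zero_le_convRadius hv.1
    rw [← h, enorm_eq_nnnorm, enorm_eq_nnnorm] at hv'
    exact_mod_cast hv'

end FPS

theorem theorem3p7 (g : ℂ⟦X⟧) :
    -- case a)
    (FPS.convRadius g = 0 → FPS.SmoothOn (FPS.comp g) (FPS.compDomain g)) ∧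
    -- case b)
    (0 < FPS.convRadius g → ∀ f ∈ FPS.compDomain g,
      (‖PowerSeries.coeff 0 f‖ₑ < FPS.convRadius g ∨
        (FPS.convRadius g < ⊤ ∧ ‖PowerSeries.coeff 0 f‖ₑ = FPS.convRadius g ∧ 0 < FPS.deg f)) →
      FPS.SmoothAt (FPS.comp g) (FPS.compDomain g) f) ∧
    -- the first derivative, in both cases
    (∀ w ∈ FPS.compDomain g,
      (FPS.convRadius g = 0 ∨
        (0 < FPS.convRadius g ∧
          (‖PowerSeries.coeff 0 w‖ₑ < FPS.convRadius g ∨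
            (FPS.convRadius g < ⊤ ∧ ‖PowerSeries.coeff 0 w‖ₑ = FPS.convRadius g ∧
              0 < FPS.deg w)))) →
      w ∈ FPS.compDomain (PowerSeries.derivative ℂ g) ∧
        ∀ k : ℂ⟦X⟧, HasDirDeriv (FPS.comp g) (FPS.compDomain g) w k
          (FPS.comp (PowerSeries.derivative ℂ g) w * k)) := by
  refine ⟨fun hr => ?_, fun hr f hf hcase => ?_, fun w hw hcase => ?_⟩
  · refine (FPS.AbsConvergentAt.zero g).dirSmoothOn_comp ?_
    rintro _ ⟨w, hw, rfl⟩
    have h := FPS.enorm_coeff_zero_le_convRadius hw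
    rw [hr] at h
    simpa [FPS.chart] using h
  · obtain ⟨s, hg, -, U, hU, hfU, hUs⟩ := FPS.exists_absConvergentAt hf (Or.inr ⟨hr, hcase⟩)
    refine ⟨mem_image_of_mem _ hf, FPS.chart.symm ⁻¹' U, hU.preimage FPS.chart.symm.continuous,
      by simpa using hfU, hg.dirSmoothOn_comp ?_⟩
    rintro _ ⟨⟨w, hw, rfl⟩, hwU⟩
    exact hUs w ⟨hw, by simpa using hwU⟩
  · obtain ⟨s, hg, hws, U, hU, hwU, hUs⟩ := FPS.exists_absConvergentAt hw hcase
    refine ⟨hg.derivative.mem_compDomain hws, fun k =>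
      (hg.hasDirDeriv_comp hws k).mono_of_eventually ?_⟩
    have hline : Continuous fun t : ℂ => w + t • k := by
      simp only [PowerSeries.smul_eq_C_mul]
      have := PowerSeries.WithPiTopology.continuous_C (R := ℂ)
      fun_prop
    have hev : ∀ᶠ t : ℂ in 𝓝 0, w + t • k ∈ U :=
      hline.continuousAt.preimage_mem_nhds (by simpa using hU.mem_nhds hwU)
    filter_upwards [hev] with t ht hmem using hUs _ ⟨hmem, ht⟩
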